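/- Let $M$ be a (Hausdorff) smooth manifold of dimension $2k+1$ and let $\omega$ be a contact form on $M$, i.e. a smooth differential 1-form such that $\omega\wedge(d\omega)^{k}\neq 0$ at every point of $M$. Let $D$ be the corresponding contact distribution, $D(x)=\{v\in T_xM \mid \omega_x(v)=0\}$. There is exactly one vector field $W$ on $M$ (the Reeb vector field of $\omega$) such that $\omega_x(W(x))=1$ and $d\omega_x(W(x),v)=0$ for all $x\in M$ and $v\in T_xM$; it is smooth, and $D$ is invariant with respect to the local one-parameter transformation group generated by $W$. That is: 1. Let $\varphi:U\to M$, $(t,x)\mapsto\varphi_t(x)$, be any smooth local flow of $W$: $U\subset\mathbb{R}\times M$ is open, for every $x$ the set $\{t \mid (t,x)\in U\}$ is empty or an interval containing $0$, $\varphi$ is smooth on $U$, $\varphi_0(x)=x$ whenever $(0,x)\in U$, and $\frac{d}{dt}\varphi_t(x)=W(\varphi_t(x))$ for all $(t,x)\in U$. Then $(d\varphi_t)_x(D(x))=D(\varphi_t(x))$ for all $(t,x)\in U$. 2. Infinitesimally: for every open set $V\subset M$ and every smooth vector field $X$ on $V$ that is tangent to $D$, the Lie bracket $[W,X]$ is tangent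 to $D$ on $V$. -/

import Mathlib

open scoped Manifold ContDiff Topology

noncomputable section

/-! ### Multilinear algebra: the wedge product of alternating forms -/

section Wedge

variable {V : Type*} [AddCommGroup V] [Module ℝ V]

/-- The wedge product `a ∧ b` of two real-valued alternating forms: the signed sum of
`a (v_σ(1), …, v_σ(m)) * b (v_σ(m+1), …, v_σ(m+n))` over all `(m, n)`-shuffles `σ`. -/
def altWedge {m n : ℕ} (a : V [⋀^Fin m]→ₗ[ℝ] ℝ) (b : V [⋀^Fin n]→ₗ[ℝ] ℝ) :
    V [⋀^Fin (m + n)]→ₗ[ℝ] ℝ :=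
  ((LinearMap.mul' ℝ ℝ).compAlternatingMap (a.domCoprod b)).domDomCongr finSumFinEquiv

/-- The `k`-th exterior power `σ ∧ ⋯ ∧ σ` of a 2-form `σ`. -/
def altWedgePow (σ : V [⋀^Fin 2]→ₗ[ℝ] ℝ) : (k : ℕ) → V [⋀^Fin (2 * k)]→ₗ[ℝ] ℝ
  | 0 => (AlternatingMap.constOfIsEmpty ℝ V (Fin 0) 1 : V [⋀^Fin 0]→ₗ[ℝ] ℝ)
  | k + 1 => altWedge (altWedgePow σ k) σ

end Wedge

/-! ### Differential forms of degree one, contact forms, Reeb vector fields and flows -/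

section Contact

variable {E : Type*} [NormedAddCommGroup E] [NormedSpace ℝ E]
  {M : Type*} [TopologicalSpace M] [ChartedSpace E M]

/-- The vector field `W` (a section of the tangent bundle) is smooth on the set `s`. -/
def IsSmoothVectorFieldOn [IsManifold 𝓘(ℝ, E) ∞ M]
    (W : (x : M) → TangentSpace 𝓘(ℝ, E) x) (s : Set M) : Prop :=
  ContMDiffOn 𝓘(ℝ, E) (𝓘(ℝ, E).prod 𝓘(ℝ, E)) ∞
    (fun x ↦ (⟨x, W x⟩ : TangentBundle 𝓘(ℝ, E) M)) s

/-- The 1-form `η` (a section of the cotangent bundle) is smooth. -/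
def IsSmoothOneForm [IsManifold 𝓘(ℝ, E) ∞ M]
    (η : (x : M) → TangentSpace 𝓘(ℝ, E) x →L[ℝ] ℝ) : Prop :=
  ContMDiff 𝓘(ℝ, E) (𝓘(ℝ, E).prod 𝓘(ℝ, E →L[ℝ] ℝ)) ∞
    (fun x ↦ Bundle.TotalSpace.mk' (E →L[ℝ] ℝ)
      (E := fun x : M ↦ TangentSpace 𝓘(ℝ, E) x →L[ℝ] ℝ) x (η x))

/-- The expression of a 1-form `η` in the preferred chart at `x₀`: the pullback of `η` by the
inverse of that chart. -/
def oneFormInChart (η : (x : M) → TangentSpace 𝓘(ℝ, E) x →L[ℝ] ℝ) (x₀ : M) (y : E) :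
    E →L[ℝ] ℝ :=
  (η ((extChartAt 𝓘(ℝ, E) x₀).symm y)).comp
    (mfderiv 𝓘(ℝ, E) 𝓘(ℝ, E) (extChartAt 𝓘(ℝ, E) x₀).symm y)

/-- The exterior derivative `dη` of a 1-form `η` at the point `x`: the exterior derivative of the
expression of `η` in the preferred chart at `x`, pulled back to the tangent space at `x`. -/
def oneFormExtDeriv (η : (x : M) → TangentSpace 𝓘(ℝ, E) x →L[ℝ] ℝ) (x : M) :
    TangentSpace 𝓘(ℝ, E) x [⋀^Fin 2]→L[ℝ] ℝ :=
  (extDeriv (fun y ↦ ContinuousAlternatingMap.ofSubsingleton ℝ E ℝ (0 : Fin 1)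
      (oneFormInChart η x y)) (extChartAt 𝓘(ℝ, E) x x)).compContinuousLinearMap
    (mfderiv 𝓘(ℝ, E) 𝓘(ℝ, E) (extChartAt 𝓘(ℝ, E) x) x)

/-- `η` is a contact form: a smooth 1-form such that `η ∧ (dη)^k` vanishes nowhere (to be used on a
manifold of dimension `2 * k + 1`). -/
def IsContactForm [IsManifold 𝓘(ℝ, E) ∞ M] (k : ℕ)
    (η : (x : M) → TangentSpace 𝓘(ℝ, E) x →L[ℝ] ℝ) : Prop :=
  IsSmoothOneForm η ∧
    ∀ x : M, altWedge
      (AlternatingMap.ofSubsingleton ℝ (TangentSpace 𝓘(ℝ, E) x) ℝ (0 : Fin 1)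
        (η x : TangentSpace 𝓘(ℝ, E) x →ₗ[ℝ] ℝ))
      (altWedgePow (oneFormExtDeriv η x).toAlternatingMap k) ≠ 0

/-- The distribution `D(x) = {v ∈ T_x M | η_x(v) = 0}`. -/
def contactDistribution (η : (x : M) → TangentSpace 𝓘(ℝ, E) x →L[ℝ] ℝ) (x : M) :
    Submodule ℝ (TangentSpace 𝓘(ℝ, E) x) :=
  LinearMap.ker (η x : TangentSpace 𝓘(ℝ, E) x →ₗ[ℝ] ℝ)

/-- `W` is a Reeb vector field of `η`: at every point `x`, `η_x(W(x)) = 1` and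
`dη_x(W(x), v) = 0` for all `v ∈ T_x M`. -/
def IsReebVectorField (η : (x : M) → TangentSpace 𝓘(ℝ, E) x →L[ℝ] ℝ)
    (W : (x : M) → TangentSpace 𝓘(ℝ, E) x) : Prop :=
  ∀ x : M, η x (W x) = 1 ∧
    ∀ v : TangentSpace 𝓘(ℝ, E) x, oneFormExtDeriv η x ![W x, v] = 0

/-- `φ`, defined on the set `U` of pairs (time, point), is a local one-parameter transformation
group generated by the vector field `W`: `U` is open, and for every point `x` the times `t` with
`(t, x) ∈ U` form an interval, which contains `0` unless it is empty; `φ` is smooth on `U`; and for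
every such `x` the curve `t ↦ φ t x` is the integral curve of `W` starting at `x`. The group law
`φ (s + t) x = φ s (φ t x)`, wherever the three expressions are defined by means of `U`, then is a
consequence of the uniqueness of integral curves. -/
structure IsLocalFlow (W : (x : M) → TangentSpace 𝓘(ℝ, E) x) (U : Set (ℝ × M))
    (φ : ℝ → M → M) : Prop where
  isOpen : IsOpen U
  ordConnected : ∀ x : M, {t : ℝ | (t, x) ∈ U}.OrdConnected
  zero_mem : ∀ (t : ℝ) (x : M), (t, x) ∈ U → ((0 : ℝ), x) ∈ U
  contMDiffOn : ContMDiffOn (𝓘(ℝ, ℝ).prod 𝓘(ℝ, E)) 𝓘(ℝ, E) ∞ (fun p : ℝ × M ↦ φ p.1 p.2) U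
  map_zero : ∀ x : M, ((0 : ℝ), x) ∈ U → φ 0 x = x
  hasMFDerivAt : ∀ (t : ℝ) (x : M), (t, x) ∈ U →
    HasMFDerivAt 𝓘(ℝ, ℝ) 𝓘(ℝ, E) (fun s : ℝ ↦ φ s x) t
      ((1 : ℝ →L[ℝ] ℝ).smulRight (W (φ t x)))

/-- The distribution `D` is invariant under the local one-parameter transformation group generated
by `W`: the differential at `x` of every transformation `φ t` maps `D(x)` onto `D(φ t x)`. -/
def IsInvariantUnderFlow (W : (x : M) → TangentSpace 𝓘(ℝ, E) x)
    (D : (x : M) → Submodule ℝ (TangentSpace 𝓘(ℝ, E) x)) : Prop :=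
  ∀ (U : Set (ℝ × M)) (φ : ℝ → M → M), IsLocalFlow W U φ →
    ∀ (t : ℝ) (x : M), (t, x) ∈ U →
      (D x).map (mfderiv 𝓘(ℝ, E) 𝓘(ℝ, E) (φ t) x :
        TangentSpace 𝓘(ℝ, E) x →ₗ[ℝ] TangentSpace 𝓘(ℝ, E) (φ t x)) = D (φ t x)

/-- For every smooth vector field `X` tangent to `D`, defined on an open set `V`, the Lie bracket
`[W, X]` is tangent to `D` on `V`. -/
def BracketPreserves [IsManifold 𝓘(ℝ, E) ∞ M] (W : (x : M) → TangentSpace 𝓘(ℝ, E) x)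
    (D : (x : M) → Submodule ℝ (TangentSpace 𝓘(ℝ, E) x)) : Prop :=
  ∀ (V : Set M) (X : (x : M) → TangentSpace 𝓘(ℝ, E) x), IsOpen V →
    IsSmoothVectorFieldOn X V → (∀ x ∈ V, X x ∈ D x) →
      ∀ x ∈ V, VectorField.mlieBracket 𝓘(ℝ, E) W X x ∈ D x

end Contact

end

/-! A vector in the kernels of both `η` and `dη` makes every term of `η ∧ (dη)^k` vanish; as this
form is nonzero and of top degree, such a vector is zero
(`eq_zero_of_altWedge_altWedgePow_ne_zero`). In odd dimension `dη` has a nonzero kernel vector, on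
which `η` is therefore nonzero; normalising gives `W`, and the same fact gives uniqueness
(`existsUnique_reeb`).

Smoothness: in a chart `W` solves the linear equation `dη(v, ·) + η(v) η = η`, whose operator is
smooth and invertible.

Bracket: `η([W, X]) = W(η(X)) - X(η(W)) - dη(W, X)`, and all three terms vanish.

Flow: pull `η` back to `θ` on time × space by `(t, z) ↦ φ_t(z)`. Since `∂_t` goes to `W`, `θ(∂_t) =
1` and `dθ(∂_t, ·) = 0`, so the spatial part of `θ` is constant in time: `φ_t` preserves `η`
(`IsLocalFlow.pullbackOneForm_eq`). Hence it also preserves `dη`, and trivial common kernel makes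
its differential injective, thus bijective. -/

noncomputable section

/-! ### Linear algebra of the pair `(η, dη)` at one point -/

section Algebra

variable {V : Type*} [AddCommGroup V] [Module ℝ V]

/-- If `a` and `b` vanish as soon as one argument is `v`, then so does `a ∧ b`. -/
theorem altWedge_apply_eq_zero {m n : ℕ} {a : V [⋀^Fin m]→ₗ[ℝ] ℝ} {b : V [⋀^Fin n]→ₗ[ℝ] ℝ} {v : V}
    (ha : ∀ w i, w i = v → a w = 0) (hb : ∀ w i, w i = v → b w = 0)
    (w : Fin (m + n) → V) (i : Fin (m + n)) (hi : w i = v) : altWedge a b w = 0 := by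
  have key : ∀ u : Fin m ⊕ Fin n → V, ∀ j, u j = v → a.domCoprod b u = 0 := by
    intro u j hj
    rw [AlternatingMap.domCoprod_apply, sum_apply]
    refine Finset.sum_eq_zero fun σ _ ↦ ?_
    induction σ using Quotient.inductionOn' with | _ σ
    rw [AlternatingMap.domCoprod.summand_mk'', _root_.smul_apply,
      MultilinearMap.domDomCongr_apply, MultilinearMap.domCoprod_apply]
    -- In each shuffle term the argument `v` is fed either to `a` or to `b`, and that factor
    -- vanishes.
    rcases h : σ⁻¹ j with l | l <;> rw [Equiv.Perm.inv_eq_iff_eq] at h <;> subst h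
    · have : a (fun i ↦ u (σ (Sum.inl i))) = 0 := ha _ l hj
      simp [this]
    · have : b (fun i ↦ u (σ (Sum.inr i))) = 0 := hb _ l hj
      simp [this]
  have := key (w ∘ finSumFinEquiv) (finSumFinEquiv.symm i) (by simpa using hi)
  simp only [altWedge, AlternatingMap.domDomCongr_apply, LinearMap.compAlternatingMap_apply]
  rw [this, map_zero]

theorem altWedgePow_apply_eq_zero {σ : V [⋀^Fin 2]→ₗ[ℝ] ℝ} {v : V}
    (hσ : ∀ w i, w i = v → σ w = 0) (k : ℕ) :
    ∀ (w : Fin (2 * k) → V) (i : Fin (2 * k)), w i = v → altWedgePow σ k w = 0 := by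
  induction k with
  | zero => exact fun w i ↦ i.elim0
  | succ k ih => exact altWedge_apply_eq_zero ih hσ

/-- A nonzero alternating form of top degree does not vanish on all families through a given nonzero
vector. -/
theorem eq_zero_of_forall_alternatingMap_apply_eq_zero {n : ℕ} [FiniteDimensional ℝ V]
    (hn : Module.finrank ℝ V = n) {f : V [⋀^Fin n]→ₗ[ℝ] ℝ} (hf : f ≠ 0) {v : V}
    (hv : ∀ w i, w i = v → f w = 0) : v = 0 := by
  by_contra h
  -- A nonzero `v` extends to a basis, and a nonzero top-degree form is nonzero on every basis.
  have hli : LinearIndepOn ℝ id ({v} : Set V) := by simpa using h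
  let b := Module.Basis.extend hli
  have hvmem : v ∈ hli.extend (Set.subset_univ _) :=
    hli.subset_extend _ rfl
  have hfin : Finite (hli.extend (Set.subset_univ ({v} : Set V))) := Module.Finite.finite_basis b
  have : Fintype (hli.extend (Set.subset_univ ({v} : Set V))) := Fintype.ofFinite _
  have hcard : Fintype.card (hli.extend (Set.subset_univ ({v} : Set V))) = n := by
    rw [← hn, Module.finrank_eq_card_basis b]
  let e := Fintype.equivFinOfCardEq hcard
  let b' := b.reindex e
  refine (f.map_basis_ne_zero_iff b').2 hf (hv _ (e ⟨v, hvmem⟩) ?_)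
  simp [b', b]

/-- `(α, σ)` has no common kernel when `α ∧ σ^k` is a nonzero form of top degree. -/
theorem eq_zero_of_altWedge_altWedgePow_ne_zero {k : ℕ} [FiniteDimensional ℝ V]
    (hn : Module.finrank ℝ V = 2 * k + 1) {α : V →ₗ[ℝ] ℝ} {σ : V [⋀^Fin 2]→ₗ[ℝ] ℝ}
    (h : altWedge (AlternatingMap.ofSubsingleton ℝ V ℝ (0 : Fin 1) α) (altWedgePow σ k) ≠ 0)
    {v : V} (hα : α v = 0) (hσ : ∀ u, σ ![v, u] = 0) : v = 0 := by
  refine eq_zero_of_forall_alternatingMap_apply_eq_zero (by rw [hn, add_comm]) h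
    (altWedge_apply_eq_zero ?_ (altWedgePow_apply_eq_zero ?_ k))
  · intro w i hi
    rw [Subsingleton.elim i 0] at hi
    simp [hi, hα]
  · intro w i hi
    fin_cases i
    · have : w = ![v, w 1] := by ext j; fin_cases j <;> simp_all
      rw [this, hσ]
    · have : w = ![v, w 0] ∘ Equiv.swap 0 1 := by ext j; fin_cases j <;> simp_all
      rw [this, AlternatingMap.map_swap _ _ (by decide), hσ, neg_zero]

theorem update_vecCons_zero {X : Type*} (a b c : X) : Function.update ![a, b] 0 c = ![c, b] := by
  ext i; fin_cases i <;> simp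

theorem update_vecCons_one {X : Type*} (a b c : X) : Function.update ![a, b] 1 c = ![a, c] := by
  ext i; fin_cases i <;> simp

/-- The bilinear form `(u, v) ↦ σ (u, v)`. -/
def altBilin (σ : V [⋀^Fin 2]→ₗ[ℝ] ℝ) : V →ₗ[ℝ] V →ₗ[ℝ] ℝ :=
  LinearMap.mk₂ ℝ (fun u v ↦ σ ![u, v])
    (fun u u' v ↦ by simpa only [update_vecCons_zero] using σ.map_update_add ![0, v] 0 u u')
    (fun c u v ↦ by simpa only [update_vecCons_zero] using σ.map_update_smul ![0, v] 0 c u)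
    (fun u v v' ↦ by simpa only [update_vecCons_one] using σ.map_update_add ![u, 0] 1 v v')
    (fun c u v ↦ by simpa only [update_vecCons_one] using σ.map_update_smul ![u, 0] 1 c v)

@[simp]
theorem altBilin_apply (σ : V [⋀^Fin 2]→ₗ[ℝ] ℝ) (u v : V) : altBilin σ u v = σ ![u, v] := rfl

theorem altBilin_self (σ : V [⋀^Fin 2]→ₗ[ℝ] ℝ) (u : V) : σ ![u, u] = 0 :=
  σ.map_eq_zero_of_eq _ (i := 0) (j := 1) rfl (by decide)

theorem altBilin_swap (σ : V [⋀^Fin 2]→ₗ[ℝ] ℝ) (u v : V) : σ ![u, v] = -σ ![v, u] := by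
  have h := altBilin_self σ (u + v)
  simp only [← altBilin_apply, map_add, LinearMap.add_apply] at h
  simp only [altBilin_apply, altBilin_self] at h
  linarith

/-- An alternating 2-form on a space of odd dimension has a nonzero kernel vector. -/
theorem exists_ne_zero_forall_apply_eq_zero [FiniteDimensional ℝ V]
    (hn : Odd (Module.finrank ℝ V)) (σ : V [⋀^Fin 2]→ₗ[ℝ] ℝ) :
    ∃ v : V, v ≠ 0 ∧ ∀ u, σ ![v, u] = 0 := by
  let b := Module.finBasis ℝ V
  let A := LinearMap.toMatrix b b.dualBasis (altBilin σ)
  have hT : A.transpose = -A := by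
    ext i j
    simp [A, LinearMap.toMatrix_apply, altBilin_swap σ (b i) (b j)]
  -- A skew matrix of odd size `n` satisfies `det A = det Aᵀ = (-1)^n det A = -det A`.
  have hdet : A.det = 0 := by
    have h := A.det_transpose
    rw [hT, Matrix.det_neg, Fintype.card_fin, hn.neg_one_pow] at h
    linarith
  obtain ⟨c, hc, hAc⟩ := Matrix.exists_mulVec_eq_zero_iff.2 hdet
  refine ⟨b.equivFun.symm c, (LinearEquiv.map_ne_zero_iff _).2 hc, fun u ↦ ?_⟩
  have h0 : altBilin σ (b.equivFun.symm c) = 0 := by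
    apply b.dualBasis.repr.injective
    ext i
    have := congrFun hAc i
    have h2 := congrFun (LinearMap.toMatrix_mulVec_repr b b.dualBasis (altBilin σ)
      (b.equivFun.symm c)) i
    have h3 : (⇑(b.repr (b.equivFun.symm c)) : _ → ℝ) = c := by
      rw [← b.equivFun_apply, LinearEquiv.apply_symm_apply]
    rw [h3] at h2
    rw [← h2, this]; simp
  rw [← altBilin_apply, h0, LinearMap.zero_apply]

/-- Existence and uniqueness of the Reeb vector in linear algebra. -/
theorem existsUnique_reeb [FiniteDimensional ℝ V] (hn : Odd (Module.finrank ℝ V))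
    {α : V →ₗ[ℝ] ℝ} {σ : V [⋀^Fin 2]→ₗ[ℝ] ℝ}
    (h : ∀ v, α v = 0 → (∀ u, σ ![v, u] = 0) → v = 0) :
    ∃! v : V, α v = 1 ∧ ∀ u, σ ![v, u] = 0 := by
  obtain ⟨v, hv, hσ⟩ := exists_ne_zero_forall_apply_eq_zero hn σ
  have hα : α v ≠ 0 := fun h0 ↦ hv (h v h0 hσ)
  refine ⟨(α v)⁻¹ • v, ⟨by simp [hα], fun u ↦ ?_⟩, fun w hw ↦ ?_⟩
  · rw [← altBilin_apply, map_smul, LinearMap.smul_apply, altBilin_apply, hσ, smul_zero]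
  · rw [← sub_eq_zero]
    refine h _ (by simp [hα, hw.1]) fun u ↦ ?_
    rw [← altBilin_apply, map_sub, map_smul, LinearMap.sub_apply, LinearMap.smul_apply,
      altBilin_apply, altBilin_apply, hσ, hw.2, smul_zero, sub_zero]

end Algebra

/-! ### Pullback of 1-forms and its compatibility with `d` -/

section OneForm

variable {F : Type*} [NormedAddCommGroup F] [NormedSpace ℝ F]

/-- The formula `dα (u, v) = u α(v) - v α(u)` for a 1-form on a normed space. -/
theorem extDeriv_ofSubsingleton_apply {α : F → F →L[ℝ] ℝ} {p : F} (hα : DifferentiableAt ℝ α p)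
    (u v : F) :
    extDeriv (fun y ↦ ContinuousAlternatingMap.ofSubsingleton ℝ F ℝ (0 : Fin 1) (α y)) p ![u, v] =
      fderiv ℝ α p u v - fderiv ℝ α p v u := by
  have h : DifferentiableAt ℝ
      (fun y ↦ ContinuousAlternatingMap.ofSubsingleton ℝ F ℝ (0 : Fin 1) (α y)) p :=
    (ContinuousAlternatingMap.ofSubsingletonLIE (𝕜 := ℝ) (E := F) (F := ℝ)
      (0 : Fin 1)).toContinuousLinearEquiv.differentiableAt.comp p hα
  rw [extDeriv_apply h, Fin.sum_univ_two]
  have (a b : F) : fderiv ℝ (fun y ↦ α y a) p b = fderiv ℝ α p b a := by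
    rw [fderiv_clm_apply hα (differentiableAt_const a)]
    simp
  simp [this, Fin.removeNth]
  ring

variable {E : Type*} [NormedAddCommGroup E] [NormedSpace ℝ E]
  {M : Type*} [TopologicalSpace M] [ChartedSpace E M]
  {η : (x : M) → TangentSpace 𝓘(ℝ, E) x →L[ℝ] ℝ}

/-- The pullback of a 1-form on a manifold by a map from a normed space. -/
def pullbackOneForm (η : (x : M) → TangentSpace 𝓘(ℝ, E) x →L[ℝ] ℝ) (f : F → M) (y : F) :
    F →L[ℝ] ℝ :=
  (η (f y)).comp (mfderiv 𝓘(ℝ, F) 𝓘(ℝ, E) f y)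

theorem pullbackOneForm_apply (f : F → M) (y v : F) :
    pullbackOneForm η f y v = η (f y) (mfderiv 𝓘(ℝ, F) 𝓘(ℝ, E) f y v) := rfl

theorem pullbackOneForm_extChartAt_symm (x : M) :
    pullbackOneForm η (extChartAt 𝓘(ℝ, E) x).symm = oneFormInChart η x := rfl

theorem pullbackOneForm_congr {f g : F → M} {y : F} (h : f =ᶠ[𝓝 y] g) :
    pullbackOneForm η f y = pullbackOneForm η g y := by
  -- All tangent spaces are `E` by definition; forgetting the dependence on the point lets the base
  -- point be rewritten.
  let η' : M → E →L[ℝ] ℝ := η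
  change (η' (f y)).comp (mfderiv 𝓘(ℝ, F) 𝓘(ℝ, E) f y : F →L[ℝ] E) =
    (η' (g y)).comp (mfderiv 𝓘(ℝ, F) 𝓘(ℝ, E) g y : F →L[ℝ] E)
  rw [h.eq_of_nhds]
  exact congrArg _ h.mfderiv_eq

theorem pullbackOneForm_comp {G : Type*} [NormedAddCommGroup G] [NormedSpace ℝ G]
    {f : F → M} {g : G → F} {y : G} (hf : MDifferentiableAt 𝓘(ℝ, F) 𝓘(ℝ, E) f (g y))
    (hg : DifferentiableAt ℝ g y) :
    pullbackOneForm η (f ∘ g) y = (pullbackOneForm η f (g y)).comp (fderiv ℝ g y) := by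
  unfold pullbackOneForm
  rw [mfderiv_comp y hf hg.mdifferentiableAt, mfderiv_eq_fderiv]
  rfl

variable [IsManifold 𝓘(ℝ, E) ∞ M]

/-- In the trivialisation of the tangent bundle at `f p`, the pullback is the composite of two
smooth maps, the coordinate expressions of `η ∘ f` and of the derivative of `f`; the trivialisation
cancels between them. -/
theorem contDiffAt_pullbackOneForm (hη : IsSmoothOneForm η) {f : F → M} {p : F}
    (hf : ContMDiffAt 𝓘(ℝ, F) 𝓘(ℝ, E) ∞ f p) : ContDiffAt ℝ ∞ (pullbackOneForm η f) p := by
  have h1 := ((contMDiffAt_hom_bundle _).1 (hη (f p))).2.comp p hf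
  have h2 := hf.mfderiv_const (m := ∞) le_rfl
  refine (h1.contDiffAt.clm_comp h2.contDiffAt).congr_of_eventuallyEq ?_
  have hmem : ∀ᶠ y in 𝓝 p, f y ∈ (trivializationAt E (TangentSpace 𝓘(ℝ, E)) (f p)).baseSet :=
    hf.continuousAt.eventually <|
      (trivializationAt E (TangentSpace 𝓘(ℝ, E)) (f p)).open_baseSet.mem_nhds
        (FiberBundle.mem_baseSet_trivializationAt' (f p))
  filter_upwards [hmem] with y hy
  ext v
  simp only [inTangentCoordinates, Function.comp_apply, id_eq, ContinuousLinearMap.comp_apply]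
  have hb : y ∈ (trivializationAt F (TangentSpace 𝓘(ℝ, F)) p).baseSet := by
    simp [TangentBundle.trivializationAt_baseSet, chartAt_self_eq]
  rw [ContinuousLinearMap.inCoordinates_eq hy (by simp), ContinuousLinearMap.inCoordinates_eq hb hy]
  have := Bundle.Trivialization.symmL_apply (R := ℝ) (trivializationAt F (TangentSpace 𝓘(ℝ, F)) p) hb v
  rw [TangentBundle.symmL_model_space] at this
  simp [pullbackOneForm_apply, Bundle.Trivialization.symm_apply_apply_mk _ hy, ← this]
  rfl

theorem contDiffAt_oneFormInChart (hη : IsSmoothOneForm η) (x : M) {y : E}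
    (hy : y ∈ (extChartAt 𝓘(ℝ, E) x).target) : ContDiffAt ℝ ∞ (oneFormInChart η x) y :=
  contDiffAt_pullbackOneForm hη ((contMDiffOn_extChartAt_symm x).contMDiffAt
    ((isOpen_extChartAt_target x).mem_nhds hy))

/-- The exterior derivative of 1-forms commutes with pullback by smooth maps. -/
theorem extDeriv_pullbackOneForm (hη : IsSmoothOneForm η) {f : F → M} {p : F}
    (hf : ContMDiffAt 𝓘(ℝ, F) 𝓘(ℝ, E) ∞ f p) :
    extDeriv (fun y ↦ ContinuousAlternatingMap.ofSubsingleton ℝ F ℝ (0 : Fin 1)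
        (pullbackOneForm η f y)) p =
      (oneFormExtDeriv η (f p)).compContinuousLinearMap (mfderiv 𝓘(ℝ, F) 𝓘(ℝ, E) f p) := by
  set x := f p
  set g : F → E := extChartAt 𝓘(ℝ, E) x ∘ f
  have hc : ContMDiffAt 𝓘(ℝ, E) 𝓘(ℝ, E) ∞ (extChartAt 𝓘(ℝ, E) x) x := contMDiffAt_extChartAt
  have hg : ContDiffAt ℝ ∞ g p := (hc.comp p hf).contDiffAt
  have hsrc : ∀ᶠ y in 𝓝 p, f y ∈ (extChartAt 𝓘(ℝ, E) x).source :=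
    hf.continuousAt.eventually (extChartAt_source_mem_nhds x)
  have hfg : ∀ᶠ y in 𝓝 p, f y = ((extChartAt 𝓘(ℝ, E) x).symm ∘ g) y :=
    hsrc.mono fun y hy ↦ ((extChartAt 𝓘(ℝ, E) x).left_inv hy).symm
  have hgd : ∀ᶠ y in 𝓝 p, DifferentiableAt ℝ g y :=
    (hg.of_le (m := 1) (by simp)).eventually (by simp) |>.mono fun y hy ↦
      hy.differentiableAt one_ne_zero
  -- Near `p`, `f` factors as the inverse chart after `g`, which reduces the claim to the pullback
  -- rule for forms on normed spaces.
  have key : ∀ᶠ y in 𝓝 p, pullbackOneForm η f y =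
      (oneFormInChart η x (g y)).comp (fderiv ℝ g y) := by
    filter_upwards [hsrc, hfg.eventually_nhds, hgd] with y hy hfy hgy
    rw [pullbackOneForm_congr hfy, pullbackOneForm_comp _ hgy, pullbackOneForm_extChartAt_symm]
    exact (((contMDiffOn_extChartAt_symm (n := ∞) x).contMDiffAt
      ((isOpen_extChartAt_target x).mem_nhds
        ((extChartAt 𝓘(ℝ, E) x).map_source hy)))).mdifferentiableAt (by simp)
  have hω : DifferentiableAt ℝ (fun y ↦ ContinuousAlternatingMap.ofSubsingleton ℝ E ℝ (0 : Fin 1)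
      (oneFormInChart η x y)) (g p) :=
    (ContinuousAlternatingMap.ofSubsingletonLIE (𝕜 := ℝ) (E := E) (F := ℝ)
      (0 : Fin 1)).toContinuousLinearEquiv.differentiableAt.comp _
      ((contDiffAt_oneFormInChart hη x (mem_extChartAt_target x)).differentiableAt (by simp))
  have h1 := extDeriv_pullback hω (hg.of_le (m := 2) (by norm_cast)) (by simp)
  have h2 : mfderiv 𝓘(ℝ, F) 𝓘(ℝ, E) g p = (mfderiv 𝓘(ℝ, E) 𝓘(ℝ, E) (extChartAt 𝓘(ℝ, E) x) x).comp
      (mfderiv 𝓘(ℝ, F) 𝓘(ℝ, E) f p) :=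
    mfderiv_comp p (hc.mdifferentiableAt (by simp)) (hf.mdifferentiableAt (by simp))
  rw [mfderiv_eq_fderiv] at h2
  rw [h2] at h1
  refine Eq.trans (Filter.EventuallyEq.extDeriv_eq ?_) h1
  filter_upwards [key] with y hy
  rw [hy]
  rfl

end OneForm

/-! ### The Reeb field in charts: smoothness and Lie bracket -/

section Reeb

open VectorField

variable {E : Type*} [NormedAddCommGroup E] [NormedSpace ℝ E]
  {M : Type*} [TopologicalSpace M] [ChartedSpace E M]
  {η : (x : M) → TangentSpace 𝓘(ℝ, E) x →L[ℝ] ℝ}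

/-- The forms `η` and `dη` have no common kernel vector. -/
def HasTrivialCommonKernel (η : (x : M) → TangentSpace 𝓘(ℝ, E) x →L[ℝ] ℝ) : Prop :=
  ∀ (x : M) (v : TangentSpace 𝓘(ℝ, E) x), η x v = 0 →
    (∀ u : TangentSpace 𝓘(ℝ, E) x, oneFormExtDeriv η x ![v, u] = 0) → v = 0

/-- The expression of a vector field in the preferred chart at `x`. -/
def vectorFieldInChart (W : (x : M) → TangentSpace 𝓘(ℝ, E) x) (x : M) (y : E) : E :=
  mpullbackWithin 𝓘(ℝ, E) 𝓘(ℝ, E) (extChartAt 𝓘(ℝ, E) x).symm W (Set.range 𝓘(ℝ, E)) y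

/-- The derivative at `y` of the inverse of the preferred chart at `x`. -/
def chartSymmDeriv (x : M) (y : E) :
    E →L[ℝ] TangentSpace 𝓘(ℝ, E) ((extChartAt 𝓘(ℝ, E) x).symm y) :=
  mfderiv 𝓘(ℝ, E) 𝓘(ℝ, E) (extChartAt 𝓘(ℝ, E) x).symm y

/-- The exterior derivative of the expression of a 1-form in the preferred chart at `x`. -/
def oneFormInChartExtDeriv (η : (x : M) → TangentSpace 𝓘(ℝ, E) x →L[ℝ] ℝ) (x : M) (y : E) :
    E →L[ℝ] E →L[ℝ] ℝ :=
  fderiv ℝ (oneFormInChart η x) y - (fderiv ℝ (oneFormInChart η x) y).flip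

theorem oneFormInChartExtDeriv_swap (x : M) (y u v : E) :
    oneFormInChartExtDeriv η x y u v = -oneFormInChartExtDeriv η x y v u := by
  simp [oneFormInChartExtDeriv]

variable [IsManifold 𝓘(ℝ, E) ∞ M]

theorem isInvertible_chartSymmDeriv {x : M} {y : E}
    (hy : y ∈ (extChartAt 𝓘(ℝ, E) x).target) :
    (chartSymmDeriv x y).IsInvertible := by
  have : IsManifold 𝓘(ℝ, E) 1 M := .of_le (n := ∞) (by simp)
  have h := isInvertible_mfderivWithin_extChartAt_symm (I := 𝓘(ℝ, E)) hy
  rwa [ModelWithCorners.range_eq_univ, mfderivWithin_univ] at h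

theorem chartSymmDeriv_vectorFieldInChart (W : (x : M) → TangentSpace 𝓘(ℝ, E) x) {x : M}
    {y : E} (hy : y ∈ (extChartAt 𝓘(ℝ, E) x).target) :
    chartSymmDeriv x y (vectorFieldInChart W x y) =
      W ((extChartAt 𝓘(ℝ, E) x).symm y) := by
  have h : vectorFieldInChart W x y =
      (chartSymmDeriv x y).inverse (W ((extChartAt 𝓘(ℝ, E) x).symm y)) := by
    rw [chartSymmDeriv, ← mfderivWithin_univ, ← ModelWithCorners.range_eq_univ 𝓘(ℝ, E)]
    rfl
  rw [h]
  exact (isInvertible_chartSymmDeriv hy).self_apply_inverse _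

theorem oneFormInChart_vectorFieldInChart (W : (x : M) → TangentSpace 𝓘(ℝ, E) x) {x : M} {y : E}
    (hy : y ∈ (extChartAt 𝓘(ℝ, E) x).target) :
    oneFormInChart η x y (vectorFieldInChart W x y) =
      η ((extChartAt 𝓘(ℝ, E) x).symm y) (W ((extChartAt 𝓘(ℝ, E) x).symm y)) := by
  rw [← chartSymmDeriv_vectorFieldInChart W hy]
  rfl

theorem oneFormInChart_mfderiv_extChartAt (x : M) (v : TangentSpace 𝓘(ℝ, E) x) :
    oneFormInChart η x (extChartAt 𝓘(ℝ, E) x x)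
      (mfderiv 𝓘(ℝ, E) 𝓘(ℝ, E) (extChartAt 𝓘(ℝ, E) x) x v) = η x v := by
  have : IsManifold 𝓘(ℝ, E) 1 M := .of_le (n := ∞) (by simp)
  let η' : M → E →L[ℝ] ℝ := η
  have h := mfderivWithin_extChartAt_symm_comp_mfderiv_extChartAt' (I := 𝓘(ℝ, E))
    (mem_extChartAt_source x)
  rw [ModelWithCorners.range_eq_univ, mfderivWithin_univ] at h
  change η' ((extChartAt 𝓘(ℝ, E) x).symm (extChartAt 𝓘(ℝ, E) x x)) (((mfderiv 𝓘(ℝ, E) 𝓘(ℝ, E)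
    (extChartAt 𝓘(ℝ, E) x).symm (extChartAt 𝓘(ℝ, E) x x)) ∘L
      (mfderiv 𝓘(ℝ, E) 𝓘(ℝ, E) (extChartAt 𝓘(ℝ, E) x) x)) v) = η' x v
  rw [h, extChartAt_to_inv]
  rfl

/-- `oneFormExtDeriv` uses a different chart at each point; commuting `d` with the pullback by one
inverse chart allows computing in that chart on its whole target. -/
theorem oneFormInChartExtDeriv_apply (hη : IsSmoothOneForm η) {x : M} {y : E}
    (hy : y ∈ (extChartAt 𝓘(ℝ, E) x).target) (u v : E) :
    oneFormInChartExtDeriv η x y u v = oneFormExtDeriv η ((extChartAt 𝓘(ℝ, E) x).symm y)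
      ![chartSymmDeriv x y u, chartSymmDeriv x y v] := by
  have h := extDeriv_pullbackOneForm hη ((contMDiffOn_extChartAt_symm (n := ∞) x).contMDiffAt
    ((isOpen_extChartAt_target x).mem_nhds hy))
  have h2 := extDeriv_ofSubsingleton_apply
    ((contDiffAt_oneFormInChart hη x hy).differentiableAt (by simp)) u v
  rw [pullbackOneForm_extChartAt_symm] at h
  rw [h] at h2
  refine Eq.trans h2.symm ?_
  change oneFormExtDeriv η _ (chartSymmDeriv x y ∘ ![u, v]) = _
  congr 1
  ext i; fin_cases i <;> rfl

theorem HasTrivialCommonKernel.eq_zero_of_inChart (hker : HasTrivialCommonKernel η)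
    (hη : IsSmoothOneForm η) {x : M} {y : E} (hy : y ∈ (extChartAt 𝓘(ℝ, E) x).target) {v : E}
    (hv : oneFormInChart η x y v = 0) (hd : ∀ u, oneFormInChartExtDeriv η x y v u = 0) :
    v = 0 := by
  have hinv := isInvertible_chartSymmDeriv hy
  refine hinv.injective ?_
  rw [map_zero]
  refine hker _ _ hv fun u ↦ ?_
  obtain ⟨w, rfl⟩ := hinv.surjective u
  rw [← oneFormInChartExtDeriv_apply hη hy, hd]

/-- The operator `v ↦ dη (v, ·) + η (v) η` in the preferred chart at `x`. -/
def reebOperator (η : (x : M) → TangentSpace 𝓘(ℝ, E) x →L[ℝ] ℝ) (x : M) (y : E) :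
    E →L[ℝ] E →L[ℝ] ℝ :=
  oneFormInChartExtDeriv η x y + (oneFormInChart η x y).smulRight (oneFormInChart η x y)

theorem contDiffAt_reebOperator (hη : IsSmoothOneForm η) {x : M} {y : E}
    (hy : y ∈ (extChartAt 𝓘(ℝ, E) x).target) : ContDiffAt ℝ ∞ (reebOperator η x) y := by
  have h := contDiffAt_oneFormInChart hη x hy
  have hd : ContDiffAt ℝ ∞ (fderiv ℝ (oneFormInChart η x)) y := h.fderiv_right (by simp)
  have hflip : ContDiff ℝ ∞ (fun B : E →L[ℝ] E →L[ℝ] ℝ ↦ B.flip) :=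
    (IsLinearMap.with_bound ⟨fun _ _ ↦ rfl, fun _ _ ↦ rfl⟩ 1
      fun B ↦ by rw [ContinuousLinearMap.opNorm_flip, one_mul]).contDiff
  have hf : ContDiffAt ℝ ∞ (fun z ↦ (fderiv ℝ (oneFormInChart η x) z).flip) y :=
    hflip.contDiffAt.comp y hd
  exact (hd.sub hf).add (h.smulRight h)

variable {W : (x : M) → TangentSpace 𝓘(ℝ, E) x}

theorem IsReebVectorField.inChart (hW : IsReebVectorField η W) (hη : IsSmoothOneForm η) {x : M}
    {y : E} (hy : y ∈ (extChartAt 𝓘(ℝ, E) x).target) :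
    oneFormInChart η x y (vectorFieldInChart W x y) = 1 ∧
      ∀ u, oneFormInChartExtDeriv η x y (vectorFieldInChart W x y) u = 0 := by
  refine ⟨(oneFormInChart_vectorFieldInChart W hy).trans (hW _).1, fun u ↦ ?_⟩
  rw [oneFormInChartExtDeriv_apply hη hy, chartSymmDeriv_vectorFieldInChart W hy]
  exact (hW _).2 _

/-- If `dη(v, ·) + η(v) η = 0`, evaluation at `W` gives `η(v) = 0`, hence `dη(v, ·) = 0` and `v =
0`. Equality of dimensions does the rest. -/
theorem isInvertible_reebOperator [FiniteDimensional ℝ E] (hker : HasTrivialCommonKernel η)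
    (hη : IsSmoothOneForm η) (hW : IsReebVectorField η W) {x : M} {y : E}
    (hy : y ∈ (extChartAt 𝓘(ℝ, E) x).target) : (reebOperator η x y).IsInvertible := by
  obtain ⟨h1, h2⟩ := hW.inChart hη hy
  have hinj : Function.Injective (reebOperator η x y : E →ₗ[ℝ] E →L[ℝ] ℝ) := by
    refine (injective_iff_map_eq_zero _).2 fun v hv ↦ ?_
    have hv' (u : E) : oneFormInChartExtDeriv η x y v u +
        oneFormInChart η x y v * oneFormInChart η x y u = 0 := by
      simpa [reebOperator] using congrArg (fun l : E →L[ℝ] ℝ ↦ l u) hv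
    have hv0 : oneFormInChart η x y v = 0 := by
      simpa [oneFormInChartExtDeriv_swap x y v, h1, h2] using hv' (vectorFieldInChart W x y)
    exact hker.eq_zero_of_inChart hη hy hv0 fun u ↦ by simpa [hv0] using hv' u
  have hdim : Module.finrank ℝ E = Module.finrank ℝ (E →L[ℝ] ℝ) := by
    rw [← (LinearMap.toContinuousLinearMap (𝕜 := ℝ) (E := E) (F' := ℝ)).finrank_eq]
    exact (Subspace.dual_finrank_eq (K := ℝ) (V := E)).symm
  exact ⟨(LinearMap.linearEquivOfInjective _ hinj hdim).toContinuousLinearEquiv, by ext; rfl⟩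

/-- The Reeb operator sends `W` to `η`, so `W` is its inverse applied to `η`, and inversion of
operators is smooth. -/
theorem IsReebVectorField.contDiffAt_vectorFieldInChart [FiniteDimensional ℝ E]
    (hker : HasTrivialCommonKernel η)
    (hη : IsSmoothOneForm η) (hW : IsReebVectorField η W) {x : M} {y : E}
    (hy : y ∈ (extChartAt 𝓘(ℝ, E) x).target) : ContDiffAt ℝ ∞ (vectorFieldInChart W x) y := by
  have : CompleteSpace E := FiniteDimensional.complete ℝ E
  have heq : vectorFieldInChart W x =ᶠ[𝓝 y]
      fun z ↦ (reebOperator η x z).inverse (oneFormInChart η x z) := by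
    filter_upwards [(isOpen_extChartAt_target x).mem_nhds hy] with z hz
    obtain ⟨h1, h2⟩ := hW.inChart hη hz
    have : reebOperator η x z (vectorFieldInChart W x z) = oneFormInChart η x z := by
      ext u
      simp [reebOperator, h1, h2]
    rw [← this, (isInvertible_reebOperator hker hη hW hz).inverse_apply_self]
  refine ContDiffAt.congr_of_eventuallyEq (ContDiffAt.clm_apply ?_
    (contDiffAt_oneFormInChart hη x hy)) heq
  exact ((isInvertible_reebOperator hker hη hW hy).contDiffAt_map_inverse).comp y
    (contDiffAt_reebOperator hη hy)

/-- The Reeb vector field is smooth. -/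
theorem IsReebVectorField.isSmoothVectorFieldOn [FiniteDimensional ℝ E]
    (hker : HasTrivialCommonKernel η) (hη : IsSmoothOneForm η) (hW : IsReebVectorField η W) :
    IsSmoothVectorFieldOn W Set.univ := by
  have : IsManifold 𝓘(ℝ, E) 1 M := .of_le (n := ∞) (by simp)
  have : CompleteSpace E := FiniteDimensional.complete ℝ E
  intro x _
  have h := contMDiffAt_vectorSpace_iff_contDiffAt.2
    (hW.contDiffAt_vectorFieldInChart hker hη (mem_extChartAt_target x))
  have h2 := ContMDiffAt.mpullback_vectorField_preimage (f := extChartAt 𝓘(ℝ, E) x) (n := ∞) h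
    contMDiffAt_extChartAt (isInvertible_mfderiv_extChartAt (mem_extChartAt_source x)) (by simp)
  refine (h2.congr_of_eventuallyEq ?_).contMDiffWithinAt
  have h3 := eventuallyEq_mpullback_mpullbackWithin_extChartAt (I := 𝓘(ℝ, E)) (s := Set.univ)
    (x := x) W
  rw [nhdsWithin_univ] at h3
  filter_upwards [h3] with z hz
  exact congrArg (Bundle.TotalSpace.mk z) hz

/-- The Lie bracket with the Reeb vector field preserves the contact distribution. -/
theorem IsReebVectorField.bracketPreserves [FiniteDimensional ℝ E]
    (hker : HasTrivialCommonKernel η) (hη : IsSmoothOneForm η) (hW : IsReebVectorField η W) :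
    BracketPreserves W (contactDistribution η) := by
  have : IsManifold 𝓘(ℝ, E) 1 M := .of_le (n := ∞) (by simp)
  have : IsManifold 𝓘(ℝ, E) 2 M := .of_le (n := ∞) (by norm_cast)
  have : CompleteSpace E := FiniteDimensional.complete ℝ E
  intro V X hV hX hXD x hx
  set c := extChartAt 𝓘(ℝ, E) x x
  have hc : c ∈ (extChartAt 𝓘(ℝ, E) x).target := mem_extChartAt_target x
  have hdX : DifferentiableAt ℝ (vectorFieldInChart X x) c := by
    have h := ((hX x hx).contMDiffAt (hV.mem_nhds hx)).contMDiffWithinAt (s := Set.univ)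
    have h' := contMDiffWithinAt_mpullbackWithin_extChartAt_symm (m := 1) (n := ∞)
      (h.of_le (by simp)) uniqueMDiffOn_univ (Set.mem_univ x) (by norm_cast)
    rw [Set.preimage_univ, Set.inter_univ, contMDiffWithinAt_vectorSpace_iff_contDiffWithinAt] at h'
    exact (h'.contDiffAt ((isOpen_extChartAt_target x).mem_nhds hc)).differentiableAt one_ne_zero
  have hdW : DifferentiableAt ℝ (vectorFieldInChart W x) c :=
    (hW.contDiffAt_vectorFieldInChart hker hη hc).differentiableAt (by simp)
  have hdα : DifferentiableAt ℝ (oneFormInChart η x) c :=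
    (contDiffAt_oneFormInChart hη x hc).differentiableAt (by simp)
  -- The Leibniz rule applied to the locally constant function `η(Y) = r`.
  have hconst (Y : (x : M) → TangentSpace 𝓘(ℝ, E) x) (r : ℝ)
      (hY : DifferentiableAt ℝ (vectorFieldInChart Y x) c)
      (h : ∀ᶠ y in 𝓝 c, oneFormInChart η x y (vectorFieldInChart Y x y) = r) (u : E) :
      oneFormInChart η x c (fderiv ℝ (vectorFieldInChart Y x) c u) +
        fderiv ℝ (oneFormInChart η x) c u (vectorFieldInChart Y x c) = 0 := by
    have h1 := fderiv_clm_apply hdα hY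
    rw [Filter.EventuallyEq.fderiv_eq (f := fun _ ↦ r) h, fderiv_fun_const] at h1
    simpa using (congrArg (fun l : E →L[ℝ] ℝ ↦ l u) h1).symm
  have hαW := hconst W 1 hdW (by
    filter_upwards [(isOpen_extChartAt_target x).mem_nhds hc] with y hy
    exact (hW.inChart hη hy).1)
  have hαX := hconst X 0 hdX (by
    have hmem : ∀ᶠ y in 𝓝 c, (extChartAt 𝓘(ℝ, E) x).symm y ∈ V :=
      (continuousAt_extChartAt_symm x).eventually
        (hV.mem_nhds (by simpa [c] using hx))
    filter_upwards [(isOpen_extChartAt_target x).mem_nhds hc, hmem] with y hy hyV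
    rw [oneFormInChart_vectorFieldInChart X hy]
    exact hXD _ hyV)
  have hd := (hW.inChart hη hc).2 (vectorFieldInChart X x c)
  simp only [oneFormInChartExtDeriv, sub_apply,
    ContinuousLinearMap.flip_apply] at hd
  have hbr : oneFormInChart η x c
      (lieBracket ℝ (vectorFieldInChart W x) (vectorFieldInChart X x) c) = 0 := by
    rw [lieBracket_eq, map_sub]
    -- With `[W, X] = DX(W) - DW(X)`, the two Leibniz identities turn `η([W, X])` into `-dη(W, X)`.
    linarith [hαW (vectorFieldInChart X x c), hαX (vectorFieldInChart W x c)]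
  have hwithin : lieBracket ℝ (vectorFieldInChart W x) (vectorFieldInChart X x) c =
      lieBracketWithin ℝ (vectorFieldInChart W x) (vectorFieldInChart X x)
        ((extChartAt 𝓘(ℝ, E) x).symm ⁻¹' Set.univ ∩ Set.range 𝓘(ℝ, E)) c := by
    rw [ModelWithCorners.range_eq_univ, Set.preimage_univ, Set.univ_inter, lieBracketWithin_univ]
  change η x _ = 0
  rw [← oneFormInChart_mfderiv_extChartAt, ← hbr, hwithin]
  congr 1
  exact (isInvertible_mfderiv_extChartAt (mem_extChartAt_source x)).self_apply_inverse _

end Reeb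

/-! ### Invariance under the local flow -/

section Flow

variable {E : Type*} [NormedAddCommGroup E] [NormedSpace ℝ E]
  {M : Type*} [TopologicalSpace M] [ChartedSpace E M]
  {η : (x : M) → TangentSpace 𝓘(ℝ, E) x →L[ℝ] ℝ}
  {W : (x : M) → TangentSpace 𝓘(ℝ, E) x} {U : Set (ℝ × M)} {φ : ℝ → M → M}

/-- A local flow read in the preferred chart at `x` of the initial point. -/
def flowInChart (φ : ℝ → M → M) (x : M) (p : ℝ × E) : M :=
  φ p.1 ((extChartAt 𝓘(ℝ, E) x).symm p.2)

theorem eventually_mem_flowDomain (hU : IsOpen U) {x : M} {t : ℝ} {y : E}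
    (hy : y ∈ (extChartAt 𝓘(ℝ, E) x).target) (hty : (t, (extChartAt 𝓘(ℝ, E) x).symm y) ∈ U) :
    ∀ᶠ p : ℝ × E in 𝓝 (t, y), (p.1, (extChartAt 𝓘(ℝ, E) x).symm p.2) ∈ U := by
  have hsymm : ContinuousAt (extChartAt 𝓘(ℝ, E) x).symm ((t, y) : ℝ × E).2 :=
    continuousAt_extChartAt_symm'' hy
  have h : ContinuousAt (fun p : ℝ × E ↦ (p.1, (extChartAt 𝓘(ℝ, E) x).symm p.2)) (t, y) :=
    continuousAt_fst.prodMk (hsymm.comp continuousAt_snd)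
  exact h.eventually (hU.mem_nhds hty)

variable [IsManifold 𝓘(ℝ, E) ∞ M]

theorem IsLocalFlow.contMDiffAt_flowInChart (hφ : IsLocalFlow W U φ) {x : M} {t : ℝ} {y : E}
    (hy : y ∈ (extChartAt 𝓘(ℝ, E) x).target) (hty : (t, (extChartAt 𝓘(ℝ, E) x).symm y) ∈ U) :
    ContMDiffAt 𝓘(ℝ, ℝ × E) 𝓘(ℝ, E) ∞ (flowInChart φ x) (t, y) := by
  have h1 : ContMDiffAt 𝓘(ℝ, E) 𝓘(ℝ, E) ∞ (extChartAt 𝓘(ℝ, E) x).symm y :=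
    (contMDiffOn_extChartAt_symm x).contMDiffAt ((isOpen_extChartAt_target x).mem_nhds hy)
  have h2 : ContMDiffAt 𝓘(ℝ, ℝ × E) 𝓘(ℝ, ℝ) ∞ (Prod.fst : ℝ × E → ℝ) (t, y) :=
    contDiffAt_fst.contMDiffAt
  have h3 : ContMDiffAt 𝓘(ℝ, ℝ × E) 𝓘(ℝ, E) ∞ (Prod.snd : ℝ × E → E) (t, y) :=
    contDiffAt_snd.contMDiffAt
  exact ((hφ.contMDiffOn _ hty).contMDiffAt (hφ.isOpen.mem_nhds hty)).comp (t, y)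
    (h2.prodMk (h1.comp (t, y) h3))

theorem IsLocalFlow.mfderiv_flowInChart_time (hφ : IsLocalFlow W U φ) {x : M} {t : ℝ} {y : E}
    (hy : y ∈ (extChartAt 𝓘(ℝ, E) x).target) (hty : (t, (extChartAt 𝓘(ℝ, E) x).symm y) ∈ U) :
    mfderiv 𝓘(ℝ, ℝ × E) 𝓘(ℝ, E) (flowInChart φ x) (t, y) ((1, 0) : ℝ × E) =
      W (flowInChart φ x (t, y)) := by
  have h1 : HasMFDerivAt 𝓘(ℝ, ℝ × E) 𝓘(ℝ, E) (flowInChart φ x) (t, y) _ :=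
    ((hφ.contMDiffAt_flowInChart hy hty).mdifferentiableAt (by simp)).hasMFDerivAt
  have h2 : HasMFDerivAt 𝓘(ℝ, ℝ) 𝓘(ℝ, ℝ × E) (fun s : ℝ ↦ (s, y)) t
      (ContinuousLinearMap.inl ℝ ℝ E) := (hasFDerivAt_prodMk_left t y).hasMFDerivAt
  have h3 := hasMFDerivAt_unique (h1.comp t h2) (hφ.hasMFDerivAt t _ hty)
  have h4 := congrArg (fun l : ℝ →L[ℝ] E ↦ l 1) h3
  exact h4.trans (one_smul ℝ _)

/-- The local flow of a Reeb vector field preserves the 1-form. -/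
theorem IsLocalFlow.pullbackOneForm_eq (hφ : IsLocalFlow W U φ) (hη : IsSmoothOneForm η)
    (hW : IsReebVectorField η W) {x : M} {t : ℝ} {y : E}
    (hy : y ∈ (extChartAt 𝓘(ℝ, E) x).target) (hty : (t, (extChartAt 𝓘(ℝ, E) x).symm y) ∈ U) :
    pullbackOneForm η (fun z ↦ flowInChart φ x (t, z)) y = oneFormInChart η x y := by
  set I : Set ℝ := {s | (s, (extChartAt 𝓘(ℝ, E) x).symm y) ∈ U}
  let θ : ℝ × E → ℝ × E →L[ℝ] ℝ := pullbackOneForm η (flowInChart φ x)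
  have hdθ {s : ℝ} (hs : s ∈ I) : DifferentiableAt ℝ θ (s, y) :=
    (contDiffAt_pullbackOneForm hη (hφ.contMDiffAt_flowInChart hy hs)).differentiableAt (by simp)
  have hslice {s : ℝ} (hs : s ∈ I) (v : E) :
      pullbackOneForm η (fun z ↦ flowInChart φ x (s, z)) y v = θ (s, y) (0, v) := by
    have h := pullbackOneForm_comp (η := η) (f := flowInChart φ x) (y := y) (g := fun z : E ↦ (s, z))
      ((hφ.contMDiffAt_flowInChart hy hs).mdifferentiableAt (by simp))
      (hasFDerivAt_prodMk_right s y).differentiableAt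
    rw [(hasFDerivAt_prodMk_right s y).fderiv] at h
    exact congrArg (fun l : E →L[ℝ] ℝ ↦ l v) h
  -- This is needed on a neighbourhood, since it is differentiated in the direction `(0, v)` below.
  have htime {s : ℝ} (hs : s ∈ I) : ∀ᶠ p in 𝓝 (s, y), θ p (1, 0) = 1 := by
    have hev : ∀ᶠ p : ℝ × E in 𝓝 (s, y), p.2 ∈ (extChartAt 𝓘(ℝ, E) x).target :=
      continuousAt_snd.eventually ((isOpen_extChartAt_target x).mem_nhds hy)
    filter_upwards [eventually_mem_flowDomain hφ.isOpen hy hs, hev] with p hp hp2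
    exact (congrArg _ (hφ.mfderiv_flowInChart_time hp2 hp)).trans (hW _).1
  -- In `dθ(∂_t, v) = ∂_t(θ(v)) - ∂_v(θ(∂_t))` the left side vanishes because `∂_t` is pushed to
  -- `W`, and the last term because `θ(∂_t) = 1`.
  have hderiv {s : ℝ} (hs : s ∈ I) (v : E) : HasDerivAt (fun r ↦ θ (r, y) (0, v)) 0 s := by
    have h1 := extDeriv_ofSubsingleton_apply (hdθ hs) (1, 0) (0, v)
    rw [extDeriv_pullbackOneForm hη (hφ.contMDiffAt_flowInChart hy hs)] at h1
    have h2 : oneFormExtDeriv η (flowInChart φ x (s, y))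
        (mfderiv 𝓘(ℝ, ℝ × E) 𝓘(ℝ, E) (flowInChart φ x) (s, y) ∘ ![((1, 0) : ℝ × E), (0, v)]) =
        0 := by
      refine Eq.trans (congrArg _ ?_) ((hW (flowInChart φ x (s, y))).2
        (mfderiv 𝓘(ℝ, ℝ × E) 𝓘(ℝ, E) (flowInChart φ x) (s, y) ((0, v) : ℝ × E)))
      ext i
      fin_cases i
      · exact hφ.mfderiv_flowInChart_time hy hs
      · rfl
    have h3 : fderiv ℝ θ (s, y) (0, v) (1, 0) = 0 := by
      have h4 := fderiv_clm_apply (hdθ hs) (differentiableAt_const ((1, 0) : ℝ × E))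
      rw [Filter.EventuallyEq.fderiv_eq (f := fun _ ↦ (1 : ℝ)) (htime hs), fderiv_fun_const] at h4
      simpa using (congrArg (fun l : ℝ × E →L[ℝ] ℝ ↦ l (0, v)) h4).symm
    have h5 : fderiv ℝ θ (s, y) (1, 0) (0, v) = 0 := by
      have h6 := h1.symm.trans h2
      rwa [h3, sub_zero] at h6
    have h7 : HasDerivAt (fun r : ℝ ↦ θ (r, y)) (fderiv ℝ θ (s, y) (1, 0)) s := by
      have := (hdθ hs).hasFDerivAt.comp_hasDerivAt s
        ((hasDerivAt_id s).prodMk (hasDerivAt_const s y))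
      exact this
    have h8 := h7.clm_apply (hasDerivAt_const s ((0, v) : ℝ × E))
    simpa [h5] using h8
  have hIopen : IsOpen I := hφ.isOpen.preimage (by fun_prop)
  have h0 : (0 : ℝ) ∈ I := hφ.zero_mem t _ hty
  ext v
  have hconst : θ (t, y) (0, v) = θ (0, y) (0, v) :=
    hIopen.is_const_of_deriv_eq_zero (hφ.ordConnected _).isPreconnected
      (fun s hs ↦ (hderiv hs v).differentiableAt.differentiableWithinAt)
      (fun s hs ↦ (hderiv hs v).deriv) hty h0
  rw [hslice hty, hconst, ← hslice h0, ← pullbackOneForm_extChartAt_symm]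
  congr 1
  -- At time 0 the flow read in the chart is the inverse chart on a neighbourhood of `y`, so the
  -- derivatives agree too.
  refine pullbackOneForm_congr ?_
  have hev := (continuousAt_const.prodMk continuousAt_id : ContinuousAt (fun z : E ↦ ((0 : ℝ), z))
    y).eventually (eventually_mem_flowDomain hφ.isOpen hy h0)
  filter_upwards [hev] with z hz
  exact hφ.map_zero _ hz

/-- Preservation of `η` gives one inclusion and, once the differential of `φ t` is surjective, the
other. Surjectivity comes from the common kernel, so neither the group law nor an inverse flow is
needed. -/
theorem IsReebVectorField.isInvariantUnderFlow [FiniteDimensional ℝ E]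
    (hker : HasTrivialCommonKernel η) (hη : IsSmoothOneForm η) (hW : IsReebVectorField η W) :
    IsInvariantUnderFlow W (contactDistribution η) := by
  intro U φ hφ t x htx
  set c := extChartAt 𝓘(ℝ, E) x x
  have hc : c ∈ (extChartAt 𝓘(ℝ, E) x).target := mem_extChartAt_target x
  have htc : (t, (extChartAt 𝓘(ℝ, E) x).symm c) ∈ U := by rwa [extChartAt_to_inv]
  let f : E → M := fun z ↦ flowInChart φ x (t, z)
  let J : E →L[ℝ] E := mfderiv 𝓘(ℝ, E) 𝓘(ℝ, E) (φ t) x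
  let C : E →L[ℝ] E := mfderiv 𝓘(ℝ, E) 𝓘(ℝ, E) (extChartAt 𝓘(ℝ, E) x) x
  let Df : E →L[ℝ] E := mfderiv 𝓘(ℝ, E) 𝓘(ℝ, E) f c
  let η' : M → E →L[ℝ] ℝ := η
  have hfs : ContMDiffAt 𝓘(ℝ, E) 𝓘(ℝ, E) ∞ f c :=
    (hφ.contMDiffAt_flowInChart hc htc).comp c
      (contDiffAt_const.prodMk contDiffAt_id : ContDiffAt ℝ ∞ (fun z : E ↦ (t, z)) c).contMDiffAt
  have hev : ∀ᶠ z in 𝓝 c, (t, (extChartAt 𝓘(ℝ, E) x).symm z) ∈ U :=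
    (continuousAt_const.prodMk continuousAt_id : ContinuousAt (fun z : E ↦ (t, z))
      c).eventually (eventually_mem_flowDomain hφ.isOpen hc htc)
  have hpull : ∀ᶠ z in 𝓝 c, pullbackOneForm η f z = oneFormInChart η x z := by
    filter_upwards [hev, (isOpen_extChartAt_target x).mem_nhds hc] with z hz hz2
    exact hφ.pullbackOneForm_eq hη hW hz2 hz
  have hJ (v : E) : J v = Df (C v) := by
    have heq : φ t =ᶠ[𝓝 x] f ∘ extChartAt 𝓘(ℝ, E) x := by
      filter_upwards [extChartAt_source_mem_nhds (I := 𝓘(ℝ, E)) x] with z hz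
      exact (congrArg (φ t) ((extChartAt 𝓘(ℝ, E) x).left_inv hz)).symm
    have h1 : J = mfderiv 𝓘(ℝ, E) 𝓘(ℝ, E) (f ∘ extChartAt 𝓘(ℝ, E) x) x := heq.mfderiv_eq
    have hcd : MDifferentiableAt 𝓘(ℝ, E) 𝓘(ℝ, E) (extChartAt 𝓘(ℝ, E) x) x :=
      (contMDiffAt_extChartAt (n := ∞)).mdifferentiableAt (by simp)
    have h2 := mfderiv_comp x (hfs.mdifferentiableAt (by simp)) hcd
    exact congrArg (fun l : E →L[ℝ] E ↦ l v) (h1.trans h2)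
  have hηJ (v : E) : η' (φ t x) (J v) = η' x v := by
    have h1 : η' (f c) (Df (C v)) = oneFormInChart η x c (C v) :=
      congrArg (fun l : E →L[ℝ] ℝ ↦ l (C v)) hpull.self_of_nhds
    have h2 : f c = φ t x := congrArg (φ t) (extChartAt_to_inv x)
    rw [h2] at h1
    rw [hJ, h1]
    exact oneFormInChart_mfderiv_extChartAt x v
  have hinj : Function.Injective J := by
    refine (injective_iff_map_eq_zero J).2 fun v hv ↦ ?_
    have hDf : Df (C v) = 0 := (hJ v).symm.trans hv
    have hCv : C v = 0 := by
      refine hker.eq_zero_of_inChart hη hc ?_ fun u ↦ ?_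
      · refine (oneFormInChart_mfderiv_extChartAt x v).trans ?_
        change η' x v = 0
        rw [← hηJ, hv, map_zero]
      -- The forms agree near `c`, so their exterior derivatives agree at `c`: `dη(C v, u)` equals
      -- `dη(Df (C v), Df u)`, and `Df (C v) = 0`.
      · have hd := extDeriv_pullbackOneForm hη hfs
        have hα := extDeriv_ofSubsingleton_apply
          ((contDiffAt_oneFormInChart hη x hc).differentiableAt (by simp)) (C v) u
        have hext := Filter.EventuallyEq.extDeriv_eq (hpull.mono fun z hz ↦ congrArg
          (ContinuousAlternatingMap.ofSubsingleton ℝ E ℝ (0 : Fin 1)) hz)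
        rw [← hext, hd] at hα
        refine hα.symm.trans ?_
        change oneFormExtDeriv η (f c) (Df ∘ ![C v, u]) = 0
        exact (oneFormExtDeriv η (f c)).map_coord_zero 0 hDf
    have : IsManifold 𝓘(ℝ, E) 1 M := .of_le (n := ∞) (by simp)
    exact (isInvertible_mfderiv_extChartAt (I := 𝓘(ℝ, E)) (mem_extChartAt_source x)).injective
      (hCv.trans (map_zero C).symm)
  have hsurj : Function.Surjective J :=
    (LinearMap.injective_iff_surjective (f := J.toLinearMap)).1 hinj
  ext w
  constructor
  · rintro ⟨v, hv, rfl⟩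
    exact (hηJ v).trans hv
  · intro hw
    obtain ⟨v, rfl⟩ := hsurj w
    exact ⟨v, (hηJ v).symm.trans hw, rfl⟩

end Flow

end

theorem mainTheorem8 (k : ℕ) {M : Type*} [TopologicalSpace M] [T2Space M]
    [ChartedSpace (EuclideanSpace ℝ (Fin (2 * k + 1))) M]
    [IsManifold 𝓘(ℝ, EuclideanSpace ℝ (Fin (2 * k + 1))) ∞ M]
    (η : (x : M) → TangentSpace 𝓘(ℝ, EuclideanSpace ℝ (Fin (2 * k + 1))) x →L[ℝ] ℝ)
    (hη : IsContactForm k η) :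
    ∃ W : (x : M) → TangentSpace 𝓘(ℝ, EuclideanSpace ℝ (Fin (2 * k + 1))) x,
      IsReebVectorField η W ∧
      (∀ W' : (x : M) → TangentSpace 𝓘(ℝ, EuclideanSpace ℝ (Fin (2 * k + 1))) x,
        IsReebVectorField η W' → W' = W) ∧
      IsSmoothVectorFieldOn W Set.univ ∧
      IsInvariantUnderFlow W (contactDistribution η) ∧
      BracketPreserves W (contactDistribution η) := by
  have hfin (x : M) : FiniteDimensional ℝ
      (TangentSpace 𝓘(ℝ, EuclideanSpace ℝ (Fin (2 * k + 1))) x) :=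
    inferInstanceAs (FiniteDimensional ℝ (EuclideanSpace ℝ (Fin (2 * k + 1))))
  have hrank (x : M) : Module.finrank ℝ
      (TangentSpace 𝓘(ℝ, EuclideanSpace ℝ (Fin (2 * k + 1))) x) = 2 * k + 1 :=
    finrank_euclideanSpace_fin (𝕜 := ℝ) (n := 2 * k + 1)
  have hker : HasTrivialCommonKernel η := fun x v hv hd ↦
    eq_zero_of_altWedge_altWedgePow_ne_zero (hrank x) (hη.2 x) hv hd
  have hex (x : M) := existsUnique_reeb
    (V := TangentSpace 𝓘(ℝ, EuclideanSpace ℝ (Fin (2 * k + 1))) x)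
    (α := (η x).toLinearMap) (σ := (oneFormExtDeriv η x).toAlternatingMap)
    (by rw [hrank]; exact odd_two_mul_add_one k) (hker x)
  choose W hW hW' using hex
  have hReeb : IsReebVectorField η W := hW
  exact ⟨W, hReeb, fun W' h ↦ funext fun x ↦ hW' x _ (h x), hReeb.isSmoothVectorFieldOn hker hη.1,
    hReeb.isInvariantUnderFlow hker hη.1, hReeb.bracketPreserves hker hη.1⟩
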